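/- Let $\gamma\in(-1,0)$ and let $f:\mathbb{R}\to\mathbb{R}$ be three times continuously differentiable with $f,f',f'',f'''\in L^1(\mathbb{R})$ (for instance $f=f_\pi:=-\phi\,\partial_xU$ with $\phi=e^{-U}$, where $\pi\propto\phi$ is the target density, whenever $f_\pi$ has these properties). Write $\hat f=\mathcal{F}f$ for the Fourier transform of $f$, in the angular frequency $\omega$, and let $$\mathcal{D}^\gamma f(x)=\mathcal{F}^{-1}\{|\omega|^\gamma\hat f(\omega)\}(x)$$ be the Riesz potential of $f$. For $h>0$ and an integer $K\ge 1$ let $$\Delta_{h,K}^\gamma f(x)=\frac1{h^\gamma}\sum_{k=-K}^{K}g_{\gamma,k}\,f(x-kh),\qquad g_{\gamma,k}=\frac{(-1)^k\,\Gamma(\gamma+1)}{\Gamma(\frac{\gamma}{2}-k+1)\,\Gamma(\frac{\gamma}{2}+k+1)} .$$ Then $|\omega|^\gamma\hat f(\omega)$ is integrable, so that $\mathcal{D}^\gamma f(x)$ is well defined for every $x$. Moreover, for every $x\in\mathbb{R}$ and every $C>0$ there are constants $M>0$ and $h_0>0$ (depending on $\gamma,f,x,C$, but not on $h$ and $K$)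 such that for all $0<h<h_0$ and all integers $K\ge1$ which satisfy the tail condition $$|f(x-kh)|\le C\exp(-|k|h)\quad\text{for all integers } k \text{ with } |k|>K,$$ one has $$\bigl|\mathcal{D}^\gamma f(x)-\Delta_{h,K}^\gamma f(x)\bigr|\le M\Bigl(h^2+\frac1{hK}\Bigr).$$ That is, the error is $\mathcal{O}(h^2+1/(hK))$ as $h\to0$, uniformly in such $K$. -/

import Mathlib

open scoped FourierTransform Topology

noncomputable section

/-- The function `|ω|^γ * f̂(ω)`, where `f̂` is the Fourier transform of `f : ℝ → ℝ`, written in the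
ordinary frequency `ξ`, the angular frequency being `ω = 2πξ`
(Mathlib: `𝓕 f ξ = ∫ y, exp (-2πi y ξ) * f y`). -/
def rieszSymbol (γ : ℝ) (f : ℝ → ℝ) (ξ : ℝ) : ℂ :=
  ((|2 * Real.pi * ξ| ^ γ : ℝ) : ℂ) * 𝓕 (fun y : ℝ => (f y : ℂ)) ξ

/-- The fractional Riesz derivative `𝓓^γ f (x) = 𝓕⁻¹ {|ω|^γ f̂(ω)} (x)`
(the Riesz potential for `-1 < γ < 0`). -/
def rieszDeriv (γ : ℝ) (f : ℝ → ℝ) (x : ℝ) : ℂ :=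
  𝓕⁻ (rieszSymbol γ f) x

/-- The coefficient
`g_{γ,k} = (-1)^k Γ(γ+1) / (Γ(γ/2 - k + 1) Γ(γ/2 + k + 1))`. -/
def centeredCoeff (γ : ℝ) (k : ℤ) : ℝ :=
  (-1 : ℝ) ^ k * Real.Gamma (γ + 1) /
    (Real.Gamma (γ / 2 - k + 1) * Real.Gamma (γ / 2 + k + 1))

/-- The truncated fractional centered difference
`Δ_{h,K}^γ f (x) = h^{-γ} ∑_{k=-K}^{K} g_{γ,k} f(x - k h)`. -/
def truncCenteredDiff (γ h : ℝ) (K : ℕ) (f : ℝ → ℝ) (x : ℝ) : ℝ :=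
  (1 / h ^ γ) * ∑ k ∈ Finset.Icc (-(K : ℤ)) (K : ℤ), centeredCoeff γ k * f (x - k * h)

/-- The tail condition at the point `x`, for the step `h`, the truncation index `K` and the
constant `C`: `|f(x - k h)| ≤ C exp(-|k| h)` for all integers `k` with `|k| > K`. -/
def TailBound (f : ℝ → ℝ) (x h : ℝ) (K : ℕ) (C : ℝ) : Prop :=
  ∀ k : ℤ, (K : ℤ) < |k| → |f (x - k * h)| ≤ C * Real.exp (-(|(k : ℝ)| * h))

end

/-! The untruncated centered difference is a Fourier multiplier: the `g_{γ,k}` are the Fourier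
coefficients of `|2 sin(πθ)|^γ` (`sineWeightCoeff_eq_centeredCoeff`), so its symbol is `h^(-γ) |2
sin(πhξ)|^γ`, to be compared with `|2πξ|^γ`. The weight is unbounded, so its Fourier series cannot
converge absolutely; Poisson summation is applied to the other factor, whose Fourier samples `f (x -
k h)` are summable by the tail condition (`hasSum_centeredCoeff_mul`).

The symbols differ by `O(h^2 |ξ|^(γ+2))` for `|hξ| ≤ 1/2`. Beyond that the sine weight blows up near
every nonzero integer value of `hξ`, so it is controlled only in the mean, over periods. Three
integrable derivatives give `𝓕 f = O(|ξ|^(-3))`, which makes both contributions `O(h^2)`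
(`norm_integral_sub_integral_le`).

For the truncation, `g_{γ,k} = O(|k|^(-1-γ))` and the exponential tail make the `k`-th term `O(1/(h
k^2))`, so the discarded sum is `O(1/(hK))`. -/

open MeasureTheory Set Real

/-! ### The sine weight and its Beta integral -/

/-- The `1`-periodic weight `|2 sin(πθ)|^γ`. -/
noncomputable def sineWeight (γ θ : ℝ) : ℝ := |2 * sin (π * θ)| ^ γ

lemma sineWeight_nonneg (γ θ : ℝ) : 0 ≤ sineWeight γ θ := rpow_nonneg (abs_nonneg _) _

lemma measurable_sineWeight (γ : ℝ) : Measurable (sineWeight γ) := by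
  unfold sineWeight; fun_prop

lemma sineWeight_add_intCast (γ θ : ℝ) (n : ℤ) : sineWeight γ (θ + n) = sineWeight γ θ := by
  unfold sineWeight
  rw [mul_add, mul_comm π (n : ℝ), sin_add_int_mul_pi]
  rcases Int.even_or_odd n with h | h <;> simp [h.neg_one_zpow]

lemma sin_pi_mul_pos {θ : ℝ} (h : θ ∈ Ioo (0 : ℝ) 1) : 0 < sin (π * θ) :=
  sin_pos_of_pos_of_lt_pi (mul_pos pi_pos h.1) (by nlinarith [pi_pos, h.2])

lemma sineWeight_of_mem_Ioo (γ : ℝ) {θ : ℝ} (h : θ ∈ Ioo (0 : ℝ) 1) :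
    sineWeight γ θ = (2 * sin (π * θ)) ^ γ := by
  rw [sineWeight, abs_of_pos (mul_pos two_pos (sin_pi_mul_pos h))]

/-- The substitution `x = (1 - cos(πθ)) / 2` turning the Beta integrand into the sine weight. -/
lemma image_one_sub_cos_div_two :
    (fun θ : ℝ => (1 - cos (π * θ)) / 2) '' Ioo 0 1 = Ioo 0 1 := by
  ext x
  constructor
  · rintro ⟨θ, h, rfl⟩
    have h1 := sin_pi_mul_pos h
    have h2 := sin_sq_add_cos_sq (π * θ)
    constructor <;> simp only <;> nlinarith
  · intro h
    refine ⟨arccos (1 - 2 * x) / π, ⟨div_pos (arccos_pos.2 (by linarith [h.1])) pi_pos, ?_⟩, ?_⟩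
    · rw [div_lt_one pi_pos]
      refine lt_of_le_of_ne (arccos_le_pi _) fun h' => ?_
      rw [arccos_eq_pi] at h'
      linarith [h.2]
    · simp only
      rw [mul_div_cancel₀ _ pi_pos.ne', cos_arccos (by linarith [h.2]) (by linarith [h.1])]
      ring

lemma injOn_one_sub_cos_div_two :
    InjOn (fun θ : ℝ => (1 - cos (π * θ)) / 2) (Ioo 0 1) := by
  intro a ha b hb h
  have h' : cos (π * a) = cos (π * b) := by simp only at h; linarith
  have := injOn_cos ⟨by nlinarith [pi_pos, ha.1], by nlinarith [pi_pos, ha.2]⟩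
    ⟨by nlinarith [pi_pos, hb.1], by nlinarith [pi_pos, hb.2]⟩ h'
  exact mul_left_cancel₀ pi_pos.ne' this

lemma hasDerivAt_one_sub_cos_div_two (θ : ℝ) :
    HasDerivAt (fun θ : ℝ => (1 - cos (π * θ)) / 2) (π * sin (π * θ) / 2) θ := by
  have h1 : HasDerivAt (fun θ : ℝ => π * θ) π θ := by
    simpa using (hasDerivAt_id θ).const_mul π
  exact ((h1.cos.const_sub 1).div_const 2).congr_deriv (by ring)

/-- With `x = (1 - cos(πθ))/2` and `s = sin(πθ)` one has `x(1-x) = (s/2)^2`, and the Jacobian `πs/2`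
raises the resulting power `γ - 1` to `γ`. -/
lemma abs_deriv_smul_beta_integrand (γ : ℝ) {θ : ℝ} (h : θ ∈ Ioo (0 : ℝ) 1) :
    |π * sin (π * θ) / 2| •
      ((((1 - cos (π * θ)) / 2 : ℝ) : ℂ) ^ ((((γ + 1) / 2 : ℝ) : ℂ) - 1) *
        (1 - (((1 - cos (π * θ)) / 2 : ℝ) : ℂ)) ^ ((((γ + 1) / 2 : ℝ) : ℂ) - 1)) =
      ((π * (4 : ℝ) ^ (-γ) : ℝ) : ℂ) * (sineWeight γ θ : ℂ) := by
  have hs := sin_pi_mul_pos h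
  have h2 := sin_sq_add_cos_sq (π * θ)
  have hx : 0 < (1 - cos (π * θ)) / 2 := by nlinarith
  have hy : 0 < 1 - (1 - cos (π * θ)) / 2 := by nlinarith
  rw [sineWeight_of_mem_Ioo γ h]
  set s := sin (π * θ)
  have e1 : ((((γ + 1) / 2 : ℝ) : ℂ) - 1) = (((γ + 1) / 2 - 1 : ℝ) : ℂ) := by push_cast; ring
  have e2 : (1 - (((1 - cos (π * θ)) / 2 : ℝ) : ℂ)) = ((1 - (1 - cos (π * θ)) / 2 : ℝ) : ℂ) := by
    push_cast; ring
  rw [e1, e2, ← Complex.ofReal_cpow hx.le, ← Complex.ofReal_cpow hy.le, Complex.real_smul,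
    ← Complex.ofReal_mul, ← Complex.ofReal_mul, ← Complex.ofReal_mul]
  congr 1
  rw [← mul_rpow hx.le hy.le]
  have e3 : (1 - cos (π * θ)) / 2 * (1 - (1 - cos (π * θ)) / 2) = (s / 2) ^ (2 : ℝ) := by
    rw [rpow_two]; linarith
  rw [e3, ← rpow_mul (by positivity), abs_of_pos (by positivity)]
  have e4 : 2 * s = 4 * (s / 2) := by ring
  have e5 : (2 : ℝ) * ((γ + 1) / 2 - 1) = γ - 1 := by ring
  have h4 : (4 : ℝ) ^ γ ≠ 0 := by positivity
  rw [e4, e5, mul_rpow (by norm_num) (by positivity), rpow_sub_one (by positivity),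
    rpow_neg (by norm_num)]
  field_simp

lemma integrableOn_sineWeight {γ : ℝ} (hγ : -1 < γ) : IntegrableOn (sineWeight γ) (Ioo 0 1) := by
  have hu : 0 < (((γ + 1) / 2 : ℝ) : ℂ).re := by rw [Complex.ofReal_re]; linarith
  have h := Complex.betaIntegral_convergent hu hu
  rw [intervalIntegrable_iff_integrableOn_Ioo_of_le zero_le_one,
    ← image_one_sub_cos_div_two,
    integrableOn_image_iff_integrableOn_abs_deriv_smul measurableSet_Ioo
      (fun θ _ => (hasDerivAt_one_sub_cos_div_two θ).hasDerivWithinAt) injOn_one_sub_cos_div_two,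
    integrableOn_congr_fun (fun θ hθ => abs_deriv_smul_beta_integrand γ hθ) measurableSet_Ioo] at h
  have hc : ((π * (4 : ℝ) ^ (-γ) : ℝ) : ℂ) ≠ 0 := by
    exact_mod_cast (by positivity : π * (4 : ℝ) ^ (-γ) ≠ 0)
  have h' := (h.const_mul (((π * (4 : ℝ) ^ (-γ) : ℝ) : ℂ)⁻¹)).re
  refine h'.congr (Filter.Eventually.of_forall fun θ => ?_)
  simp only
  rw [inv_mul_cancel_left₀ hc]
  simp

lemma integral_sineWeight {γ : ℝ} (hγ : -1 < γ) :
    ∫ θ in (0 : ℝ)..1, (sineWeight γ θ : ℂ) = (Gamma (γ + 1) / Gamma (γ / 2 + 1) ^ 2 : ℝ) := by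
  have hu : 0 < (((γ + 1) / 2 : ℝ) : ℂ).re := by rw [Complex.ofReal_re]; linarith
  have h := Complex.Gamma_mul_Gamma_eq_betaIntegral hu hu
  have hG : 0 < Gamma (γ + 1) := Gamma_pos_of_pos (by linarith)
  have hG2 : 0 < Gamma (γ / 2 + 1) := Gamma_pos_of_pos (by linarith)
  have hdup := Real.Gamma_mul_Gamma_add_half ((γ + 1) / 2)
  rw [Complex.betaIntegral, intervalIntegral.integral_of_le zero_le_one, integral_Ioc_eq_integral_Ioo,
    ← image_one_sub_cos_div_two,
    integral_image_eq_integral_abs_deriv_smul measurableSet_Ioo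
      (fun θ _ => (hasDerivAt_one_sub_cos_div_two θ).hasDerivWithinAt) injOn_one_sub_cos_div_two,
    setIntegral_congr_fun measurableSet_Ioo (fun θ hθ => abs_deriv_smul_beta_integrand γ hθ),
    integral_const_mul, ← integral_Ioc_eq_integral_Ioo,
    ← intervalIntegral.integral_of_le zero_le_one, Complex.Gamma_ofReal, ← Complex.ofReal_add,
    Complex.Gamma_ofReal, intervalIntegral.integral_ofReal] at h
  rw [intervalIntegral.integral_ofReal]
  norm_cast at h ⊢
  set J := ∫ θ in (0 : ℝ)..1, sineWeight γ θ
  have e1 : (γ + 1) / 2 + (γ + 1) / 2 = γ + 1 := by ring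
  have e2 : (γ + 1) / 2 + 1 / 2 = γ / 2 + 1 := by ring
  have e3 : 2 * ((γ + 1) / 2) = γ + 1 := by ring
  have e4 : 1 - (γ + 1) = -γ := by ring
  have e5 : (4 : ℝ) ^ (-γ) = 2 ^ (-γ) * 2 ^ (-γ) := by
    rw [← mul_rpow] <;> norm_num
  rw [e1, e5] at h
  rw [e2, e3, e4] at hdup
  have hp : (0 : ℝ) < 2 ^ (-γ) := by positivity
  set p := (2 : ℝ) ^ (-γ)
  set a := Gamma ((γ + 1) / 2)
  have hsq : √π * √π = π := mul_self_sqrt pi_pos.le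
  rw [eq_div_iff (by positivity)]
  -- The duplication formula enters squared, since the Beta identity contains `a * a`.
  have hq : (a * Gamma (γ / 2 + 1)) * (a * Gamma (γ / 2 + 1)) =
      (Gamma (γ + 1) * p * √π) * (Gamma (γ + 1) * p * √π) := by rw [hdup]
  have : Gamma (γ + 1) * π * p * p * (J * Gamma (γ / 2 + 1) ^ 2) =
      Gamma (γ + 1) * π * p * p * Gamma (γ + 1) := by
    linear_combination (-(Gamma (γ / 2 + 1) ^ 2)) * h + hq + Gamma (γ + 1) ^ 2 * p ^ 2 * hsq
  exact mul_left_cancel₀ (by positivity) this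

lemma intervalIntegrable_sineWeight {γ : ℝ} (hγ : -1 < γ) :
    IntervalIntegrable (sineWeight γ) volume 0 1 :=
  (intervalIntegrable_iff_integrableOn_Ioo_of_le zero_le_one).2 (integrableOn_sineWeight hγ)

/-! ### Fourier coefficients of the sine weight -/

/-- The Fourier coefficients of `|2 sin(πθ)|^γ`. -/
noncomputable def sineWeightCoeff (γ : ℝ) (k : ℤ) : ℂ :=
  ∫ θ in (0 : ℝ)..1, (sineWeight γ θ : ℂ) * Complex.exp (2 * π * Complex.I * k * θ)

lemma intervalIntegrable_sineWeight_mul_exp {γ : ℝ} (hγ : -1 < γ) (k : ℤ) :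
    IntervalIntegrable (fun θ : ℝ => (sineWeight γ θ : ℂ) *
      Complex.exp (2 * π * Complex.I * k * θ)) volume 0 1 :=
  IntervalIntegrable.mul_continuousOn
    ⟨(intervalIntegrable_sineWeight hγ).1.ofReal, (intervalIntegrable_sineWeight hγ).2.ofReal⟩ (by fun_prop)

/-- Integrate the derivative of `(2 sin(πθ))^(γ+1) e^{πi(2k+1)θ}` over a period. The boundary terms
vanish because `γ + 1 > 0`, and writing `sin`, `cos` through `e^{±πiθ}` splits the derivative into
the integrands for `k + 1` and `k`. -/
lemma sineWeightCoeff_add_one {γ : ℝ} (hγ : -1 < γ) (k : ℤ) :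
    (γ + 2 * k + 2) * sineWeightCoeff γ (k + 1) = (2 * k - γ) * sineWeightCoeff γ k := by
  have hcont : ContinuousOn (fun θ : ℝ => (((2 * sin (π * θ)) ^ (γ + 1) : ℝ) : ℂ) *
      Complex.exp (π * Complex.I * (2 * k + 1) * θ)) (Icc 0 1) := by
    refine Continuous.continuousOn (Continuous.mul (Complex.continuous_ofReal.comp ?_) (by fun_prop))
    exact Continuous.rpow_const (by fun_prop) fun _ => Or.inr (by linarith)
  have hderiv : ∀ θ ∈ Ioo (0 : ℝ) 1, HasDerivAt
      (fun θ : ℝ => (((2 * sin (π * θ)) ^ (γ + 1) : ℝ) : ℂ) *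
        Complex.exp (π * Complex.I * (2 * k + 1) * θ))
      (π * (γ + 2 * k + 2) * ((sineWeight γ θ : ℂ) *
          Complex.exp (2 * π * Complex.I * ((k + 1 : ℤ) : ℂ) * θ)) -
        π * (2 * k - γ) * ((sineWeight γ θ : ℂ) * Complex.exp (2 * π * Complex.I * k * θ))) θ := by
    intro θ hθ
    have hs := sin_pi_mul_pos hθ
    have h1 : HasDerivAt (fun θ : ℝ => π * θ) π θ := by
      simpa using (hasDerivAt_id θ).const_mul π
    have h2 := ((h1.sin.const_mul 2).rpow_const (p := γ + 1) (Or.inl (by positivity))).ofReal_comp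
    have h3 : HasDerivAt (fun θ : ℝ => Complex.exp (π * Complex.I * (2 * k + 1) * θ))
        (Complex.exp (π * Complex.I * (2 * k + 1) * θ) * (π * Complex.I * (2 * k + 1))) θ := by
      have := ((hasDerivAt_id θ).ofReal_comp.const_mul (π * Complex.I * (2 * k + 1))).cexp
      simpa using this
    refine (h2.mul h3).congr_deriv ?_
    rw [sineWeight_of_mem_Ioo γ hθ, add_sub_cancel_right, rpow_add_one (by positivity)]
    have c1 : Complex.exp (2 * π * Complex.I * ((k + 1 : ℤ) : ℂ) * θ) =
        Complex.exp (π * Complex.I * (2 * k + 1) * θ) * Complex.exp ((π * θ : ℝ) * Complex.I) := by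
      rw [← Complex.exp_add]; congr 1; push_cast; ring
    have c2 : Complex.exp (2 * π * Complex.I * k * θ) =
        Complex.exp (π * Complex.I * (2 * k + 1) * θ) * Complex.exp (-(π * θ : ℝ) * Complex.I) := by
      rw [← Complex.exp_add]; congr 1; push_cast; ring
    rw [c1, c2, Complex.exp_mul_I, Complex.exp_mul_I, Complex.cos_neg, Complex.sin_neg,
      ← Complex.ofReal_cos, ← Complex.ofReal_sin]
    push_cast
    ring
  have hint1 := (intervalIntegrable_sineWeight_mul_exp hγ (k + 1)).const_mul
    ((π : ℂ) * (γ + 2 * k + 2))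
  have hint2 := (intervalIntegrable_sineWeight_mul_exp hγ k).const_mul ((π : ℂ) * (2 * k - γ))
  have key := intervalIntegral.integral_eq_sub_of_hasDerivAt_of_le zero_le_one hcont hderiv
    (hint1.sub hint2)
  rw [intervalIntegral.integral_sub hint1 hint2, intervalIntegral.integral_const_mul,
    intervalIntegral.integral_const_mul] at key
  simp only [mul_one, mul_zero, sin_pi, sin_zero, zero_rpow (by linarith : γ + 1 ≠ 0),
    Complex.ofReal_zero, zero_mul, sub_zero] at key
  have hpi : (π : ℂ) ≠ 0 := by exact_mod_cast pi_pos.ne'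
  refine mul_left_cancel₀ hpi ?_
  unfold sineWeightCoeff
  linear_combination key

lemma gamma_half_add_int_ne {γ : ℝ} (hγ : γ ∈ Ioo (-1 : ℝ) 0) (k : ℤ) : γ / 2 + k ≠ 0 := by
  intro h
  obtain ⟨h1, h2⟩ := hγ
  have h3 : (0 : ℝ) < k := by linarith
  have h4 : (k : ℝ) < 1 := by linarith
  have h5 : 0 < k := by exact_mod_cast h3
  have h6 : k < 1 := by exact_mod_cast h4
  omega

lemma Gamma_half_add_int_ne_zero {γ : ℝ} (hγ : γ ∈ Ioo (-1 : ℝ) 0) (k : ℤ) :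
    Gamma (γ / 2 + k) ≠ 0 := by
  refine Real.Gamma_ne_zero fun m h => gamma_half_add_int_ne hγ (k + m) ?_
  push_cast
  linarith

lemma centeredCoeff_add_one {γ : ℝ} (hγ : γ ∈ Ioo (-1 : ℝ) 0) (k : ℤ) :
    (γ + 2 * k + 2) * centeredCoeff γ (k + 1) = (2 * k - γ) * centeredCoeff γ k := by
  unfold centeredCoeff
  have n1 := gamma_half_add_int_ne hγ (-k)
  have n2 := gamma_half_add_int_ne hγ (k + 1)
  have g1 := Gamma_half_add_int_ne_zero hγ (-k)
  have g2 := Gamma_half_add_int_ne_zero hγ (k + 1)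
  have r1 := Real.Gamma_add_one n1
  have r2 := Real.Gamma_add_one n2
  push_cast at *
  have e1 : γ / 2 - (k + 1) + 1 = γ / 2 + -k := by ring
  have e2 : γ / 2 - (k : ℝ) + 1 = γ / 2 + -k + 1 := by ring
  have e3 : γ / 2 + (k : ℝ) + 1 = γ / 2 + (k + 1) := by ring
  rw [e1, e2, e3, r1, r2, zpow_add_one₀ (by norm_num)]
  have e4 : γ + 2 * k + 2 = 2 * (γ / 2 + (k + 1)) := by ring
  have e5 : 2 * k - γ = -2 * (γ / 2 + -k) := by ring
  rw [e4, e5]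
  generalize Gamma (γ / 2 + -k) = a at *
  generalize Gamma (γ / 2 + (k + 1)) = b at *
  generalize γ / 2 + -k = u at *
  generalize γ / 2 + (k + 1) = v at *
  field_simp

/-- Both sequences satisfy the same first-order recurrence and agree at `0`. Its factors never
vanish, as `γ/2` is not an integer, so it can be run in both directions. -/
lemma sineWeightCoeff_eq_centeredCoeff {γ : ℝ} (hγ : γ ∈ Ioo (-1 : ℝ) 0) (k : ℤ) :
    sineWeightCoeff γ k = centeredCoeff γ k := by
  have step (k : ℤ) := sineWeightCoeff_add_one hγ.1 k
  have step' (k : ℤ) : ((γ + 2 * k + 2 : ℝ) : ℂ) * centeredCoeff γ (k + 1) =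
      ((2 * k - γ : ℝ) : ℂ) * centeredCoeff γ k := by
    exact_mod_cast congrArg Complex.ofReal (centeredCoeff_add_one hγ k)
  induction k using Int.induction_on with
  | zero =>
    simp only [sineWeightCoeff, centeredCoeff]
    have := integral_sineWeight hγ.1
    simp only [Int.cast_zero, mul_zero, zero_mul, Complex.exp_zero, mul_one, zpow_zero, one_mul,
      sub_zero, add_zero, ← sq]
    exact this
  | succ k ih =>
    have h := step k
    have h' := step' k
    rw [ih] at h
    have hne : ((γ + 2 * (k : ℤ) + 2 : ℝ) : ℂ) ≠ 0 := by
      have := gamma_half_add_int_ne hγ (k + 1)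
      rw [Complex.ofReal_ne_zero]
      intro h0
      apply this
      push_cast at *
      linarith
    refine mul_left_cancel₀ hne ?_
    rw [h']
    push_cast at *
    exact h
  | pred k ih =>
    have h := step (-k - 1)
    have h' := step' (-k - 1)
    rw [sub_add_cancel, ih] at h
    rw [sub_add_cancel] at h'
    have hne : ((2 * (-k - 1 : ℤ) - γ : ℝ) : ℂ) ≠ 0 := by
      have := gamma_half_add_int_ne hγ (k + 1)
      rw [Complex.ofReal_ne_zero]
      intro h0
      apply this
      push_cast at *
      linarith
    refine mul_left_cancel₀ hne ?_
    rw [← h']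
    push_cast at *
    exact h.symm

/-! ### Decay of the coefficients and the truncation tail -/

lemma centeredCoeff_neg (γ : ℝ) (k : ℤ) : centeredCoeff γ (-k) = centeredCoeff γ k := by
  unfold centeredCoeff
  have h : ((-1 : ℝ)) ^ (-k) = (-1) ^ k := by
    rw [zpow_neg, ← inv_zpow]; norm_num
  rw [h, mul_comm (Gamma _) (Gamma (γ / 2 + k + 1))]
  push_cast
  rw [sub_neg_eq_add, ← sub_eq_add_neg]

/-- With `y = k - γ/2` the recurrence gives the ratio `y / (y + 1 + γ)`, and Bernoulli's inequality
for the exponent `1 + γ ∈ (0,1)` gives `(1 + 1/y)^(1+γ) ≤ 1 + (1+γ)/y`. -/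
lemma rpow_mul_abs_centeredCoeff_succ_le {γ : ℝ} (hγ : γ ∈ Ioo (-1 : ℝ) 0) (k : ℕ) :
    ((k + 1 : ℕ) - γ / 2) ^ (1 + γ) * |centeredCoeff γ (k + 1 : ℕ)| ≤
      (k - γ / 2) ^ (1 + γ) * |centeredCoeff γ k| := by
  obtain ⟨h1, h2⟩ := hγ
  have hk : (0 : ℝ) ≤ k := k.cast_nonneg
  have hy : 0 < (k : ℝ) - γ / 2 := by linarith
  have hrec := congrArg abs (centeredCoeff_add_one ⟨h1, h2⟩ k)
  rw [abs_mul, abs_mul] at hrec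
  push_cast at hrec ⊢
  rw [abs_of_pos (by linarith : 0 < γ + 2 * (k : ℝ) + 2),
    abs_of_pos (by linarith : 0 < 2 * (k : ℝ) - γ)] at hrec
  have hbern := rpow_one_add_le_one_add_mul_self (s := 1 / ((k : ℝ) - γ / 2))
    (by have := one_div_pos.2 hy; linarith) (by linarith : 0 ≤ 1 + γ) (by linarith)
  have e : (k : ℝ) + 1 - γ / 2 = (k - γ / 2) * (1 + 1 / (k - γ / 2)) := by
    rw [mul_one_add, mul_one_div_cancel hy.ne']; ring
  have hpos : 0 < ((k : ℝ) - γ / 2) ^ (1 + γ) := by positivity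
  rw [e, mul_rpow hy.le (by positivity), mul_assoc]
  refine mul_le_mul_of_nonneg_left ?_ hpos.le
  calc _ ≤ (1 + (1 + γ) * (1 / (k - γ / 2))) * |centeredCoeff γ (k + 1)| :=
        mul_le_mul_of_nonneg_right hbern (abs_nonneg _)
    _ = ((γ + 2 * k + 2) * |centeredCoeff γ (k + 1)|) / (2 * k - γ) := by
        rw [show 2 * (k : ℝ) - γ = 2 * (k - γ / 2) by ring,
          show γ + 2 * (k : ℝ) + 2 = 2 * ((k - γ / 2) + (1 + γ)) by ring]
        generalize (k : ℝ) - γ / 2 = y at hy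
        field_simp
    _ = |centeredCoeff γ k| := by
        rw [hrec]
        have : 2 * (k : ℝ) - γ ≠ 0 := by linarith
        field_simp

lemma exists_abs_centeredCoeff_le {γ : ℝ} (hγ : γ ∈ Ioo (-1 : ℝ) 0) :
    ∃ c : ℝ, 0 < c ∧ ∀ k : ℤ, k ≠ 0 → |centeredCoeff γ k| ≤ c * |(k : ℝ)| ^ (-(1 + γ)) := by
  have hp : 0 < (0 - γ / 2) := by linarith [hγ.2]
  have key (k : ℕ) : (k - γ / 2) ^ (1 + γ) * |centeredCoeff γ k| ≤
      (0 - γ / 2) ^ (1 + γ) * |centeredCoeff γ 0| := by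
    induction k with
    | zero => simp
    | succ k ih => exact (rpow_mul_abs_centeredCoeff_succ_le hγ k).trans ih
  refine ⟨(0 - γ / 2) ^ (1 + γ) * |centeredCoeff γ 0| + 1, by positivity, fun k hk => ?_⟩
  have hnat (n : ℕ) (hn : 0 < n) : |centeredCoeff γ n| ≤
      ((0 - γ / 2) ^ (1 + γ) * |centeredCoeff γ 0| + 1) * (n : ℝ) ^ (-(1 + γ)) := by
    have hn' : (0 : ℝ) < n := by exact_mod_cast hn
    rw [rpow_neg hn'.le, ← div_eq_mul_inv, le_div_iff₀ (by positivity), mul_comm]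
    have hle : (n : ℝ) ^ (1 + γ) ≤ (n - γ / 2) ^ (1 + γ) :=
      rpow_le_rpow hn'.le (by linarith) (by linarith [hγ.1])
    have := mul_le_mul_of_nonneg_right hle (abs_nonneg (centeredCoeff γ n))
    linarith [key n]
  rcases Int.natAbs_eq k with h | h
  · rw [h]
    simpa using hnat k.natAbs (Int.natAbs_pos.2 hk)
  · rw [h, centeredCoeff_neg]
    simpa using hnat k.natAbs (Int.natAbs_pos.2 hk)

lemma tendsto_sum_Icc_neg {a : ℤ → ℂ} {S : ℂ} (ha : HasSum a S) :
    Filter.Tendsto (fun N : ℕ => ∑ k ∈ Finset.Icc (-(N : ℤ)) N, a k) Filter.atTop (𝓝 S) := by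
  have ha' : Filter.Tendsto (fun s : Finset ℤ => ∑ k ∈ s, a k) Filter.atTop (𝓝 S) := by
    simpa [HasSum] using ha
  exact ha'.comp Finset.tendsto_Icc_neg

lemma norm_hasSum_sub_sum_Icc_le {a : ℤ → ℂ} {S : ℂ} (ha : HasSum a S) {K : ℕ} (hK : 1 ≤ K)
    {B : ℝ} (hB : 0 ≤ B) (hle : ∀ k : ℤ, (K : ℤ) < |k| → ‖a k‖ ≤ B / (k : ℝ) ^ 2) :
    ‖S - ∑ k ∈ Finset.Icc (-(K : ℤ)) K, a k‖ ≤ 2 * B / K := by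
  have hK' : (0 : ℝ) < K := by exact_mod_cast hK
  -- Telescoping form of the bound, from `1/(N+1)^2 ≤ 1/N - 1/(N+1)`; the factor 2 counts the two
  -- signs of `k`.
  have hN (N : ℕ) (h : K ≤ N) :
      ‖∑ k ∈ Finset.Icc (-(N : ℤ)) N, a k - ∑ k ∈ Finset.Icc (-(K : ℤ)) K, a k‖ ≤
        2 * B * (1 / K - 1 / N) := by
    induction N, h using Nat.le_induction with
    | base => simp
    | succ N h ih =>
      have hNpos : (0 : ℝ) < N := hK'.trans_le (by exact_mod_cast h)
      rw [Nat.cast_add, Nat.cast_one, Finset.Icc_succ_succ, Finset.sum_union (by simp),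
        Finset.sum_pair (by lia), add_sub_right_comm]
      have h1 := hle (-(N + 1 : ℤ)) (by rw [abs_neg, abs_of_nonneg] <;> omega)
      have h2 := hle (N + 1 : ℤ) (by rw [abs_of_nonneg] <;> omega)
      push_cast at h1 h2 ⊢
      rw [neg_sq] at h1
      have h3 : B / ((N : ℝ) + 1) ^ 2 ≤ B * (1 / N - 1 / (N + 1)) := by
        rw [div_eq_mul_one_div]
        refine mul_le_mul_of_nonneg_left ?_ hB
        rw [div_sub_div _ _ hNpos.ne' (by positivity), div_le_div_iff₀ (by positivity)
          (by positivity)]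
        nlinarith
      refine (norm_add_le _ _).trans ?_
      have h4 := norm_add_le (a (-(N + 1))) (a (N + 1))
      linarith
  refine le_of_tendsto ((tendsto_sum_Icc_neg ha).sub_const _).norm ?_
  filter_upwards [Filter.eventually_ge_atTop K] with N h
  refine (hN N h).trans ?_
  rw [mul_div_assoc, ← mul_div_assoc, div_eq_mul_one_div (2 * B)]
  refine mul_le_mul_of_nonneg_left ?_ (by positivity)
  have : (0 : ℝ) ≤ 1 / N := by positivity
  linarith

/-- `t^s ≤ max 1 (t^2) ≤ 2 e^t`. This trades the exponential tail for whichever power is convenient.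
-/
lemma exp_neg_le_two_mul_rpow {s t : ℝ} (hs0 : 0 ≤ s) (hs : s ≤ 2) (ht : 0 < t) :
    exp (-t) ≤ 2 * t ^ (-s) := by
  have h1 : t ^ s ≤ 2 * exp t := by
    have hq := quadratic_le_exp_of_nonneg ht.le
    rcases le_total t 1 with h | h
    · have := rpow_le_one ht.le h hs0
      nlinarith
    · have := rpow_le_rpow_of_exponent_le h hs
      rw [rpow_two] at this
      nlinarith
  rw [exp_neg, rpow_neg ht.le, ← div_eq_mul_inv, le_div_iff₀ (by positivity), mul_comm,
    ← div_eq_mul_inv, div_le_iff₀ (exp_pos _)]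
  exact h1

lemma TailBound.summable {f : ℝ → ℝ} {x h C : ℝ} {K : ℕ} (hb : TailBound f x h K C) (hC : 0 < C)
    (hh : 0 < h) : Summable fun k : ℤ => f (x - k * h) := by
  have hs : Summable fun k : ℤ => 2 * C / h ^ 2 * (1 / (k : ℝ) ^ 2) :=
    (Real.summable_one_div_int_pow.2 one_lt_two).mul_left _
  refine Summable.of_norm_bounded_eventually hs ?_
  refine Set.Finite.subset (Set.finite_Icc (-(K : ℤ)) K) fun k hk => ?_
  by_contra hk'
  refine hk ?_
  have habs : (K : ℤ) < |k| := by
    rw [Set.mem_Icc, ← abs_le] at hk'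
    exact not_le.1 hk'
  have hk0 : (0 : ℝ) < |(k : ℝ)| := by
    rw [abs_pos]; rintro h0
    have : k = 0 := by exact_mod_cast h0
    subst this; simp at habs; omega
  refine (hb k habs).trans ?_
  refine (mul_le_mul_of_nonneg_left (exp_neg_le_two_mul_rpow zero_le_two le_rfl
    (mul_pos hk0 hh)) hC.le).trans_eq ?_
  rw [rpow_neg (by positivity), rpow_two, mul_pow, sq_abs]
  field_simp

lemma abs_centeredCoeff_mul_le_of_tailBound {γ c : ℝ} (hγ : γ ∈ Ioo (-1 : ℝ) 0) (hc : 0 < c)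
    (hg : ∀ k : ℤ, k ≠ 0 → |centeredCoeff γ k| ≤ c * |(k : ℝ)| ^ (-(1 + γ)))
    {f : ℝ → ℝ} {x h C : ℝ} {K : ℕ} (hb : TailBound f x h K C) (hC : 0 < C) (hh : 0 < h)
    {k : ℤ} (hk : (K : ℤ) < |k|) :
    |h ^ (-γ) * (centeredCoeff γ k * f (x - k * h))| ≤ (2 * c * C / h) / (k : ℝ) ^ 2 := by
  have hk0 : k ≠ 0 := by rintro rfl; simp at hk; omega
  have hk1 : (0 : ℝ) < |(k : ℝ)| := abs_pos.2 (by exact_mod_cast hk0)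
  rw [abs_mul, abs_mul, abs_of_pos (by positivity : 0 < h ^ (-γ))]
  -- The exponent `1 - γ` makes the powers of `|k|` add up to `-2` and those of `h` to `-1`.
  have he := exp_neg_le_two_mul_rpow (s := 1 - γ) (by linarith [hγ.2]) (by linarith [hγ.1])
    (mul_pos hk1 hh)
  calc _ ≤ h ^ (-γ) * ((c * |(k : ℝ)| ^ (-(1 + γ))) *
        (C * (2 * (|(k : ℝ)| * h) ^ (-(1 - γ))))) := by
        refine mul_le_mul_of_nonneg_left (mul_le_mul (hg k hk0) ((hb k hk).trans ?_)
          (abs_nonneg _) (by positivity)) (by positivity)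
        exact mul_le_mul_of_nonneg_left he hC.le
    _ = 2 * c * C * (h ^ (-γ) * h ^ (-(1 - γ))) *
        (|(k : ℝ)| ^ (-(1 + γ)) * |(k : ℝ)| ^ (-(1 - γ))) := by
        rw [mul_rpow hk1.le hh.le]; ring
    _ = (2 * c * C / h) / (k : ℝ) ^ 2 := by
        rw [← rpow_add hh, ← rpow_add hk1, show -γ + -(1 - γ) = -1 by ring,
          show -(1 + γ) + -(1 - γ) = -2 by ring, rpow_neg_one, rpow_neg hk1.le, rpow_two, sq_abs]
        field_simp

/-! ### Integrability of the weights on the line -/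

lemma summable_one_div_one_add_int_sq : Summable fun n : ℤ => 1 / (1 + (n : ℝ) ^ 2) := by
  refine Summable.of_norm_bounded_eventually (Real.summable_one_div_int_pow.2 one_lt_two) ?_
  refine Set.Finite.subset (Set.finite_singleton (0 : ℤ)) fun n hn => ?_
  by_contra h0
  refine hn ?_
  have h1 : (0 : ℝ) < (n : ℝ) ^ 2 := by
    have : (n : ℝ) ≠ 0 := by exact_mod_cast h0
    positivity
  rw [Set.mem_ofPred_eq, norm_of_nonneg (by positivity)]
  exact one_div_le_one_div_of_le h1 (by linarith)

lemma one_div_one_add_sq_le {θ : ℝ} (hθ : θ ∈ Ioc (0 : ℝ) 1) (n : ℤ) :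
    1 / (1 + (θ + n) ^ 2) ≤ 3 * (1 / (1 + (n : ℝ) ^ 2)) := by
  rw [← div_eq_mul_one_div, div_le_div_iff₀ (by positivity) (by positivity)]
  nlinarith [sq_nonneg ((n : ℝ) + 2 * θ), hθ.1, hθ.2]

/-- The singularities at the integers are handled period by period: the interval at `n` contributes
at most `3/(1+n^2)` times the integral over one period. -/
lemma integrable_sineWeight_div {γ : ℝ} (hγ : -1 < γ) :
    Integrable fun θ : ℝ => sineWeight γ θ / (1 + θ ^ 2) := by
  have hmeas : Measurable fun θ : ℝ => sineWeight γ θ / (1 + θ ^ 2) :=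
    (measurable_sineWeight γ).div (by fun_prop)
  have hI := (intervalIntegrable_iff_integrableOn_Ioc_of_le zero_le_one).1
    (intervalIntegrable_sineWeight hγ)
  have hle (n : ℤ) {θ : ℝ} (hθ : θ ∈ Ioc (0 : ℝ) 1) :
      ‖sineWeight γ (θ + n) / (1 + (θ + n) ^ 2)‖ ≤
        3 * (1 / (1 + (n : ℝ) ^ 2)) * sineWeight γ θ := by
    have h0 := sineWeight_nonneg γ θ
    rw [sineWeight_add_intCast, norm_of_nonneg (by positivity), div_eq_mul_one_div, mul_comm]
    exact mul_le_mul_of_nonneg_right (one_div_one_add_sq_le hθ n) h0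
  have hshift (n : ℤ) :
      IntegrableOn (fun θ : ℝ => sineWeight γ (θ + n) / (1 + (θ + n) ^ 2)) (Ioc 0 1) := by
    refine (hI.const_mul (3 * (1 / (1 + (n : ℝ) ^ 2)))).mono'
      (hmeas.comp (measurable_id.add_const _)).aestronglyMeasurable ?_
    filter_upwards [ae_restrict_mem measurableSet_Ioc] with θ hθ using hle n hθ
  rw [← integrableOn_univ, ← iUnion_Ioc_intCast ℝ]
  refine integrableOn_iUnion_of_summable_integral_norm (fun n => ?_) ?_
  · rw [← intervalIntegrable_iff_integrableOn_Ioc_of_le (by linarith)]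
    have h1 := (intervalIntegrable_iff_integrableOn_Ioc_of_le zero_le_one).2 (hshift n)
    have h2 := h1.comp_sub_right (n : ℝ)
    simpa [add_comm] using h2
  · refine Summable.of_nonneg_of_le (fun n => integral_nonneg fun _ => norm_nonneg _) (fun n => ?_)
      ((summable_one_div_one_add_int_sq.mul_left 3).mul_right (∫ θ in Ioc (0 : ℝ) 1, sineWeight γ θ))
    have h3 : ∫ θ in Ioc (n : ℝ) (n + 1), ‖sineWeight γ θ / (1 + θ ^ 2)‖ =
        ∫ θ in Ioc (0 : ℝ) 1, ‖sineWeight γ (θ + n) / (1 + (θ + n) ^ 2)‖ := by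
      rw [← intervalIntegral.integral_of_le (by linarith),
        ← intervalIntegral.integral_of_le zero_le_one,
        intervalIntegral.integral_comp_add_right (fun θ => ‖sineWeight γ θ / (1 + θ ^ 2)‖)]
      simp [add_comm]
    rw [h3, ← integral_const_mul]
    exact setIntegral_mono_on (hshift n).norm (hI.const_mul _) measurableSet_Ioc
      fun θ hθ => hle n hθ

lemma integrable_abs_rpow_div {s : ℝ} (h1 : -1 < s) (h2 : s < 2) :
    Integrable fun ξ : ℝ => |ξ| ^ s / (1 + |ξ| ^ 3) := by
  have hmeas : Measurable fun ξ : ℝ => |ξ| ^ s / (1 + |ξ| ^ 3) := by fun_prop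
  have hIoc : IntegrableOn (fun ξ : ℝ => |ξ| ^ s / (1 + |ξ| ^ 3)) (Ioc 0 1) := by
    refine ((intervalIntegrable_iff_integrableOn_Ioc_of_le zero_le_one).1
      (intervalIntegral.intervalIntegrable_rpow' h1)).mono' hmeas.aestronglyMeasurable ?_
    filter_upwards [ae_restrict_mem measurableSet_Ioc] with ξ hξ
    rw [norm_of_nonneg (by positivity), abs_of_pos hξ.1]
    have := hξ.1
    exact div_le_self (by positivity) (by linarith [pow_pos this 3])
  have hIoi1 : IntegrableOn (fun ξ : ℝ => |ξ| ^ s / (1 + |ξ| ^ 3)) (Ioi 1) := by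
    refine (integrableOn_Ioi_rpow_of_lt (by linarith : s - 3 < -1) one_pos).mono'
      hmeas.aestronglyMeasurable ?_
    filter_upwards [ae_restrict_mem measurableSet_Ioi] with ξ hξ
    have hξ0 : 0 < ξ := zero_lt_one.trans hξ
    rw [norm_of_nonneg (by positivity), abs_of_pos hξ0, rpow_sub hξ0]
    norm_cast
    gcongr
    linarith
  have hIoi : IntegrableOn (fun ξ : ℝ => |ξ| ^ s / (1 + |ξ| ^ 3)) (Ioi 0) := by
    rw [← Ioc_union_Ioi_eq_Ioi zero_le_one]
    exact hIoc.union hIoi1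
  have hIio : IntegrableOn (fun ξ : ℝ => |ξ| ^ s / (1 + |ξ| ^ 3)) (Iio 0) := by
    rw [← neg_zero] at hIoi
    simpa using hIoi.comp_neg_Iio
  rw [← integrableOn_univ, ← Iic_union_Ioi (a := (0 : ℝ))]
  exact ((integrableOn_Iic_iff_integrableOn_Iio (by simp)).2 hIio).union hIoi

/-! ### Pointwise comparison of the two symbols -/

lemma one_sub_sq_div_two_le_sin_div {u : ℝ} (h0 : 0 < u) (h1 : u ≤ π / 2) :
    1 - u ^ 2 / 2 ≤ sin u / u := by
  refine one_sub_sq_div_two_le_cos.trans ?_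
  rw [le_div_iff₀ h0]
  rcases h1.eq_or_lt with rfl | h1
  · simp
  · have hc := cos_pos_of_mem_Ioo ⟨by linarith [pi_pos], h1⟩
    have := le_tan h0.le h1
    rw [tan_eq_sin_div_cos, le_div_iff₀ hc] at this
    linarith

/-- For `r = sin u / u ≤ 1` and `-1 < γ < 0`, `1 ≤ r^γ ≤ 1/r`, so the error is at most `(1 - r)/r`;
Jordan's inequality bounds `1/r` by `π/2`. -/
lemma abs_rpow_sin_div_sub_one_le {γ u : ℝ} (hγ : γ ∈ Ioo (-1 : ℝ) 0) (h0 : 0 < u)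
    (h1 : u ≤ π / 2) : |(sin u / u) ^ γ - 1| ≤ π / 4 * u ^ 2 := by
  have hr0 : 2 / π ≤ sin u / u := by
    rw [le_div_iff₀ h0]; exact mul_le_sin h0.le h1
  have hr1 : sin u / u ≤ 1 := (div_le_one h0).2 (sin_le h0.le)
  have hr2 := one_sub_sq_div_two_le_sin_div h0 h1
  set r := sin u / u
  have hpi := pi_pos
  have hrpos : 0 < r := lt_of_lt_of_le (by positivity) hr0
  have hge : 1 ≤ r ^ γ := one_le_rpow_of_pos_of_le_one_of_nonpos hrpos hr1 hγ.2.le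
  have hle : r ^ γ ≤ r⁻¹ := by
    rw [← rpow_neg_one]
    exact rpow_le_rpow_of_exponent_ge hrpos hr1 hγ.1.le
  have hinv : r⁻¹ ≤ π / 2 := by
    rw [inv_le_comm₀ hrpos (by positivity)]
    simpa using hr0
  rw [abs_of_nonneg (by linarith)]
  have : r⁻¹ - 1 = r⁻¹ * (1 - r) := by field_simp
  calc _ ≤ r⁻¹ * (1 - r) := by linarith
    _ ≤ π / 2 * (u ^ 2 / 2) := mul_le_mul hinv (by linarith) (by linarith) (by positivity)
    _ = _ := by ring

lemma abs_sineWeight_sub_le_of_pos {γ η : ℝ} (hγ : γ ∈ Ioo (-1 : ℝ) 0) (h0 : 0 < η)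
    (h1 : η ≤ 1 / 2) :
    |sineWeight γ η - |2 * π * η| ^ γ| ≤ π ^ 3 * |η| ^ (γ + 2) := by
  have hpi := pi_pos
  have hpi2 := two_le_pi
  have hu0 : 0 < π * η := by positivity
  have hu1 : π * η ≤ π / 2 := by nlinarith
  have hs : 0 < sin (π * η) := sin_pi_mul_pos ⟨h0, by linarith⟩
  have key := abs_rpow_sin_div_sub_one_le hγ hu0 hu1
  rw [sineWeight, abs_of_pos (by positivity : 0 < 2 * sin (π * η)),
    abs_of_pos (by positivity : 0 < 2 * π * η), abs_of_pos h0]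
  have e : 2 * sin (π * η) = (2 * π * η) * (sin (π * η) / (π * η)) := by field_simp
  rw [e, mul_rpow (by positivity) (by positivity), ← mul_sub_one, abs_mul,
    abs_of_pos (by positivity : 0 < (2 * π * η) ^ γ), mul_rpow (by positivity) h0.le, rpow_add h0, rpow_two]
  have hle : (2 * π) ^ γ ≤ 1 := rpow_le_one_of_one_le_of_nonpos (by linarith) hγ.2.le
  have hηγ : 0 < η ^ γ := by positivity
  calc _ ≤ (1 * η ^ γ) * (π / 4 * (π * η) ^ 2) := by gcongr
    _ = π ^ 3 * (η ^ γ * η ^ 2) / 4 := by ring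
    _ ≤ π ^ 3 * (η ^ γ * η ^ 2) := div_le_self (by positivity) (by norm_num)

/-- The part of the sine weight outside the central period. -/
noncomputable def outerSineWeight (γ θ : ℝ) : ℝ := if |θ| ≤ 1 / 2 then 0 else sineWeight γ θ

/-- Outside the central period the pure power is absorbed by `π^3 |η|^(γ+2)`, because `π^3 η^2 ≥ 1`
there. The sine weight, singular at the integers, is not, and is kept as a separate term. -/
lemma abs_sineWeight_sub_le {γ : ℝ} (hγ : γ ∈ Ioo (-1 : ℝ) 0) (η : ℝ) :
    |sineWeight γ η - |2 * π * η| ^ γ| ≤ π ^ 3 * |η| ^ (γ + 2) + outerSineWeight γ η := by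
  have hpi := pi_pos
  have hpi2 := two_le_pi
  unfold outerSineWeight
  split_ifs with h
  · rw [add_zero]
    rcases lt_trichotomy η 0 with hη | rfl | hη
    · have := abs_sineWeight_sub_le_of_pos hγ (η := -η) (by linarith) (by rwa [abs_of_neg hη] at h)
      simpa [sineWeight] using this
    -- At `η = 0` both singular powers take the default value `0 ^ γ = 0`.
    · simp [sineWeight, zero_rpow hγ.2.ne, zero_rpow (by linarith [hγ.1] : γ + 2 ≠ 0)]
    · exact abs_sineWeight_sub_le_of_pos hγ hη (by rwa [abs_of_pos hη] at h)
  · push Not at h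
    have hη : 0 < |η| := by linarith
    have hb : |2 * π * η| ^ γ ≤ π ^ 3 * |η| ^ (γ + 2) := by
      rw [abs_mul, abs_of_pos (by positivity : 0 < 2 * π), mul_rpow (by positivity) hη.le,
        rpow_add hη, rpow_two]
      have hle : (2 * π) ^ γ ≤ 1 := rpow_le_one_of_one_le_of_nonpos (by linarith) hγ.2.le
      have hηγ : 0 < |η| ^ γ := by positivity
      have h8 : 8 ≤ π ^ 3 := by
        calc (8 : ℝ) = 2 ^ 3 := by norm_num
          _ ≤ π ^ 3 := by gcongr
      have h4 : 1 ≤ 8 * |η| ^ 2 := by nlinarith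
      have : 1 ≤ π ^ 3 * |η| ^ 2 := h4.trans (by gcongr)
      calc _ ≤ 1 * |η| ^ γ := by gcongr
        _ ≤ (π ^ 3 * |η| ^ 2) * |η| ^ γ := by gcongr
        _ = _ := by ring
    have h0 := sineWeight_nonneg γ η
    have h1 : 0 ≤ |2 * π * η| ^ γ := by positivity
    rw [abs_le]
    constructor <;> linarith

/-- For `t = |hξ| > 1/2`, `1/(1+|ξ|^3) = h^3/(h^3+t^3)`, and `1 + t^2 ≤ 10 t^3` with equality at `t
= 1/2`. -/
lemma outerSineWeight_div_le {γ h : ℝ} (hh : 0 < h) (ξ : ℝ) :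
    outerSineWeight γ (h * ξ) / (1 + |ξ| ^ 3) ≤
      10 * h ^ 3 * (sineWeight γ (h * ξ) / (1 + (h * ξ) ^ 2)) := by
  have h0 := sineWeight_nonneg γ (h * ξ)
  unfold outerSineWeight
  split_ifs with hc
  · rw [zero_div]; positivity
  · push Not at hc
    rw [mul_div_assoc', div_le_div_iff₀ (by positivity) (by positivity), mul_assoc, mul_assoc,
      ← mul_assoc, mul_comm (10 * h ^ 3), mul_assoc]
    refine mul_le_mul_of_nonneg_left ?_ h0
    have e : (1 + |ξ| ^ 3) * (10 * h ^ 3) = 10 * h ^ 3 + 10 * |h * ξ| ^ 3 := by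
      rw [abs_mul, abs_of_pos hh]; ring
    rw [e, ← sq_abs (h * ξ)]
    have : 0 < h ^ 3 := by positivity
    set t := |h * ξ|
    nlinarith [mul_pos (sub_pos.2 hc) (sub_pos.2 hc), mul_nonneg (sq_nonneg t) (sub_pos.2 hc).le]

/-! ### Poisson summation against the sine weight -/

lemma hasSum_integral_sineWeight_mul {γ : ℝ} (hγ : -1 < γ) {u : ℤ → ℝ → ℂ} {b : ℤ → ℝ}
    (hu : ∀ n, Continuous (u n)) (hb : Summable b)
    (hle : ∀ n, ∀ θ ∈ Ioc (0 : ℝ) 1, ‖u n θ‖ ≤ b n) :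
    HasSum (fun n => ∫ θ in (0 : ℝ)..1, (sineWeight γ θ : ℂ) * u n θ)
      (∫ θ in (0 : ℝ)..1, (sineWeight γ θ : ℂ) * ∑' n, u n θ) := by
  have hI : uIoc (0 : ℝ) 1 = Ioc 0 1 := uIoc_of_le zero_le_one
  refine intervalIntegral.hasSum_integral_of_dominated_convergence
    (fun n θ => sineWeight γ θ * b n) (fun n => ?_) (fun n => ?_) ?_ ?_ ?_
  · exact ((Complex.measurable_ofReal.comp (measurable_sineWeight γ)).mul
      (hu n).measurable).aestronglyMeasurable
  · refine Filter.Eventually.of_forall fun θ hθ => ?_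
    rw [hI] at hθ
    rw [norm_mul, Complex.norm_of_nonneg (sineWeight_nonneg γ θ)]
    exact mul_le_mul_of_nonneg_left (hle n θ hθ) (sineWeight_nonneg γ θ)
  · exact Filter.Eventually.of_forall fun θ _ => hb.mul_left _
  · simp_rw [tsum_mul_left]
    exact (intervalIntegrable_sineWeight hγ).mul_const _
  · refine Filter.Eventually.of_forall fun θ hθ => ?_
    rw [hI] at hθ
    exact (Summable.of_norm_bounded hb fun n => hle n θ hθ).hasSum.mul_left _

lemma integrable_sineWeight_mul {γ c : ℝ} (hγ : -1 < γ) {Ψ : ℝ → ℂ} (hΨ : Continuous Ψ)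
    (hle : ∀ θ, ‖Ψ θ‖ ≤ c / (1 + θ ^ 2)) :
    Integrable fun θ : ℝ => (sineWeight γ θ : ℂ) * Ψ θ := by
  refine ((integrable_sineWeight_div hγ).const_mul c).mono'
    ((Complex.measurable_ofReal.comp (measurable_sineWeight γ)).mul
      hΨ.measurable).aestronglyMeasurable (Filter.Eventually.of_forall fun θ => ?_)
  rw [norm_mul, Complex.norm_of_nonneg (sineWeight_nonneg γ θ)]
  refine (mul_le_mul_of_nonneg_left (hle θ) (sineWeight_nonneg γ θ)).trans_eq ?_
  ring

/-- Parseval's identity for the sine weight and the periodization of `Ψ`. -/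
lemma hasSum_sineWeightCoeff_mul_fourier {γ c : ℝ} (hγ : -1 < γ) (hc : 0 ≤ c) {Ψ : ℝ → ℂ}
    (hΨ : Continuous Ψ) (hle : ∀ θ, ‖Ψ θ‖ ≤ c / (1 + θ ^ 2))
    (hs : Summable fun n : ℤ => 𝓕 Ψ n) :
    HasSum (fun n : ℤ => sineWeightCoeff γ n * 𝓕 Ψ n) (∫ θ, (sineWeight γ θ : ℂ) * Ψ θ) := by
  have hO : Ψ =O[Filter.cocompact ℝ] fun θ : ℝ => |θ| ^ (-2 : ℝ) := by
    refine Asymptotics.IsBigO.of_bound c ?_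
    filter_upwards [isCompact_singleton.compl_mem_cocompact (s := ({0} : Set ℝ))] with θ hθ
    have hθ0 : 0 < |θ| := abs_pos.2 hθ
    rw [norm_of_nonneg (by positivity), rpow_neg hθ0.le, rpow_two, sq_abs, ← div_eq_mul_inv]
    refine (hle θ).trans ?_
    have : 0 < θ ^ 2 := by rw [← sq_abs]; positivity
    gcongr
    linarith
  have hpoisson := Real.tsum_eq_tsum_fourier_of_rpow_decay_of_summable hΨ one_lt_two hO hs
  have hunfold : ∫ θ, (sineWeight γ θ : ℂ) * Ψ θ =
      ∫ θ in (0 : ℝ)..1, (sineWeight γ θ : ℂ) * ∑' n : ℤ, Ψ (θ + n) := by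
    refine (integrable_sineWeight_mul hγ hΨ hle).hasSum_intervalIntegral_comp_add_int.unique ?_
    simp_rw [sineWeight_add_intCast]
    refine hasSum_integral_sineWeight_mul hγ (u := fun (n : ℤ) θ => Ψ (θ + n))
      (b := fun n => c * (3 * (1 / (1 + (n : ℝ) ^ 2)))) (fun n => by fun_prop)
      ((summable_one_div_one_add_int_sq.mul_left 3).mul_left c) fun n θ hθ => ?_
    refine (hle _).trans ?_
    rw [div_eq_mul_one_div]
    exact mul_le_mul_of_nonneg_left (one_div_one_add_sq_le hθ n) hc
  -- Termwise integration rests on the summability of the `𝓕 Ψ n` alone, the exponentials having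
  -- modulus one; no summability of the weight's coefficients is needed.
  have hcoeff : HasSum
      (fun n : ℤ => ∫ θ in (0 : ℝ)..1, (sineWeight γ θ : ℂ) *
        (𝓕 Ψ n * Complex.exp (2 * π * Complex.I * n * θ)))
      (∫ θ in (0 : ℝ)..1, (sineWeight γ θ : ℂ) *
        ∑' n : ℤ, 𝓕 Ψ n * Complex.exp (2 * π * Complex.I * n * θ)) := by
    refine hasSum_integral_sineWeight_mul hγ
      (u := fun (n : ℤ) (θ : ℝ) => 𝓕 Ψ n * Complex.exp (2 * π * Complex.I * n * θ))
      (b := fun n : ℤ => ‖𝓕 Ψ n‖) (fun n => by fun_prop) hs.norm fun n θ _ => ?_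
    have e : 2 * π * Complex.I * n * θ = ((2 * π * n * θ : ℝ) : ℂ) * Complex.I := by
      push_cast; ring
    rw [norm_mul, e, Complex.norm_exp_ofReal_mul_I, mul_one]
  have hfun (θ : ℝ) : ∑' n : ℤ, 𝓕 Ψ n * Complex.exp (2 * π * Complex.I * n * θ) =
      ∑' n : ℤ, Ψ (θ + n) := by
    rw [hpoisson]
    refine tsum_congr fun n => ?_
    rw [fourier_coe_apply]
    simp
  simp_rw [hfun] at hcoeff
  rw [hunfold]
  convert hcoeff using 2 with n
  rw [sineWeightCoeff, ← intervalIntegral.integral_mul_const]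
  refine intervalIntegral.integral_congr fun θ _ => ?_
  ring

/-! ### Quadratic error between the two symbols -/

lemma one_div_one_add_abs_pow_three_le {h : ℝ} (hh0 : 0 < h) (hh1 : h ≤ 1) (ξ : ℝ) :
    1 / (1 + |ξ| ^ 3) ≤ 2 / (1 + (h * ξ) ^ 2) := by
  rw [div_le_div_iff₀ (by positivity) (by positivity), mul_pow, ← sq_abs ξ]
  have h2 : h ^ 2 ≤ 1 := pow_le_one₀ hh0.le hh1
  have h0 := abs_nonneg ξ
  have h3 : h ^ 2 * |ξ| ^ 2 ≤ 1 * |ξ| ^ 2 := by gcongr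
  generalize |ξ| = t at *
  have : t ^ 2 ≤ 1 + t ^ 3 := by
    rcases le_total t 1 with ht | ht
    · have := pow_le_one₀ (n := 2) h0 ht
      have := pow_nonneg h0 3
      linarith
    · have := pow_le_pow_right₀ ht (show 2 ≤ 3 by norm_num)
      linarith
  have := pow_nonneg h0 3
  linarith

section CubicDecay

variable {γ A h : ℝ} {Φ : ℝ → ℂ}

lemma integrable_abs_rpow_mul (hγ : γ ∈ Ioo (-1 : ℝ) 0) (hΦ : Continuous Φ)
    (hA : ∀ ξ, ‖Φ ξ‖ ≤ A / (1 + |ξ| ^ 3)) :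
    Integrable fun ξ : ℝ => ((|2 * π * ξ| ^ γ : ℝ) : ℂ) * Φ ξ := by
  have hm : Measurable fun ξ : ℝ => |2 * π * ξ| ^ γ := by fun_prop
  refine ((integrable_abs_rpow_div hγ.1 (by linarith [hγ.2])).const_mul
    ((2 * π) ^ γ * A)).mono' ((Complex.measurable_ofReal.comp hm).mul
      hΦ.measurable).aestronglyMeasurable (Filter.Eventually.of_forall fun ξ => ?_)
  rw [norm_mul, Complex.norm_of_nonneg (by positivity)]
  refine (mul_le_mul_of_nonneg_left (hA ξ) (by positivity)).trans_eq ?_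
  rw [abs_mul, abs_of_pos (by positivity : 0 < 2 * π), mul_rpow (by positivity) (abs_nonneg _)]
  ring

lemma integrable_scaled_sineWeight_mul (hγ : γ ∈ Ioo (-1 : ℝ) 0) (hh0 : 0 < h) (hh1 : h ≤ 1)
    (hA0 : 0 ≤ A) (hΦ : Continuous Φ) (hA : ∀ ξ, ‖Φ ξ‖ ≤ A / (1 + |ξ| ^ 3)) :
    Integrable fun ξ : ℝ => ((h ^ (-γ) * sineWeight γ (h * ξ) : ℝ) : ℂ) * Φ ξ := by
  have hm : Measurable fun ξ : ℝ => h ^ (-γ) * sineWeight γ (h * ξ) :=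
    ((measurable_sineWeight γ).comp (measurable_const_mul h)).const_mul _
  refine (((integrable_sineWeight_div hγ.1).comp_mul_left' hh0.ne').const_mul
    (h ^ (-γ) * A * 2)).mono' ((Complex.measurable_ofReal.comp hm).mul
      hΦ.measurable).aestronglyMeasurable (Filter.Eventually.of_forall fun ξ => ?_)
  have h0 : 0 ≤ h ^ (-γ) * sineWeight γ (h * ξ) :=
    mul_nonneg (by positivity) (sineWeight_nonneg _ _)
  rw [norm_mul, Complex.norm_of_nonneg h0]
  refine (mul_le_mul_of_nonneg_left ((hA ξ).trans ?_) h0).trans_eq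
    (?_ : _ * (A * (2 / (1 + (h * ξ) ^ 2))) = _)
  · rw [div_eq_mul_one_div]
    exact mul_le_mul_of_nonneg_left (one_div_one_add_abs_pow_three_le hh0 hh1 ξ) hA0
  · ring

/-- By homogeneity the difference is `h^(-γ)` times the unscaled one at `hξ`. In the power term
`h^(-γ) h^(γ+2) = h^2`; in the outer term `h^(-γ) ≤ 1` is dropped. -/
lemma abs_rpow_sub_scaled_sineWeight_div_le (hγ : γ ∈ Ioo (-1 : ℝ) 0) (hh0 : 0 < h)
    (hh1 : h ≤ 1) (ξ : ℝ) :
    |(|2 * π * ξ| ^ γ - h ^ (-γ) * sineWeight γ (h * ξ))| / (1 + |ξ| ^ 3) ≤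
      π ^ 3 * h ^ 2 * (|ξ| ^ (γ + 2) / (1 + |ξ| ^ 3)) +
        10 * h ^ 3 * (sineWeight γ (h * ξ) / (1 + (h * ξ) ^ 2)) := by
  have hscale : |2 * π * ξ| ^ γ = h ^ (-γ) * |2 * π * (h * ξ)| ^ γ := by
    rw [show 2 * π * (h * ξ) = h * (2 * π * ξ) by ring, abs_mul h, abs_of_pos hh0,
      mul_rpow hh0.le (abs_nonneg _), ← mul_assoc, ← rpow_add hh0, neg_add_cancel, rpow_zero,
      one_mul]
  have hpow : h ^ (-γ) * |h * ξ| ^ (γ + 2) = h ^ 2 * |ξ| ^ (γ + 2) := by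
    rw [abs_mul, abs_of_pos hh0, mul_rpow hh0.le (abs_nonneg _), ← mul_assoc, ← rpow_add hh0,
      neg_add_cancel_left, rpow_two]
  have hh : 0 < h ^ (-γ) := by positivity
  have hle1 : h ^ (-γ) ≤ 1 := rpow_le_one hh0.le hh1 (by linarith [hγ.2])
  have hout : 0 ≤ outerSineWeight γ (h * ξ) := by
    unfold outerSineWeight
    split_ifs
    exacts [le_rfl, sineWeight_nonneg _ _]
  rw [hscale, ← mul_sub, abs_mul, abs_of_pos hh, abs_sub_comm]
  calc _ ≤ h ^ (-γ) * (π ^ 3 * |h * ξ| ^ (γ + 2) + outerSineWeight γ (h * ξ)) / (1 + |ξ| ^ 3) := by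
        gcongr
        exact abs_sineWeight_sub_le hγ _
    _ = π ^ 3 * (h ^ (-γ) * |h * ξ| ^ (γ + 2)) / (1 + |ξ| ^ 3) +
          h ^ (-γ) * (outerSineWeight γ (h * ξ) / (1 + |ξ| ^ 3)) := by ring
    _ ≤ π ^ 3 * (h ^ (-γ) * |h * ξ| ^ (γ + 2)) / (1 + |ξ| ^ 3) +
          1 * (outerSineWeight γ (h * ξ) / (1 + |ξ| ^ 3)) := by gcongr
    _ ≤ _ := by
        rw [hpow, one_mul]
        exact add_le_add (by apply le_of_eq; ring) (outerSineWeight_div_le hh0 ξ)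

lemma norm_integral_sub_integral_le (hγ : γ ∈ Ioo (-1 : ℝ) 0) (hh0 : 0 < h) (hh1 : h ≤ 1)
    (hA0 : 0 ≤ A) (hΦ : Continuous Φ) (hA : ∀ ξ, ‖Φ ξ‖ ≤ A / (1 + |ξ| ^ 3)) :
    ‖(∫ ξ, ((|2 * π * ξ| ^ γ : ℝ) : ℂ) * Φ ξ) -
        ∫ ξ, ((h ^ (-γ) * sineWeight γ (h * ξ) : ℝ) : ℂ) * Φ ξ‖ ≤
      A * (π ^ 3 * (∫ ξ : ℝ, |ξ| ^ (γ + 2) / (1 + |ξ| ^ 3)) +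
        10 * ∫ θ, sineWeight γ θ / (1 + θ ^ 2)) * h ^ 2 := by
  have hint1 := integrable_abs_rpow_div (s := γ + 2) (by linarith [hγ.1]) (by linarith [hγ.2])
  have hint2 := (integrable_sineWeight_div hγ.1).comp_mul_left' hh0.ne'
  have hint : Integrable fun ξ : ℝ => A * (π ^ 3 * h ^ 2 * (|ξ| ^ (γ + 2) / (1 + |ξ| ^ 3)) +
      10 * h ^ 3 * (sineWeight γ (h * ξ) / (1 + (h * ξ) ^ 2))) :=
    ((hint1.const_mul _).add (hint2.const_mul _)).const_mul _
  rw [← integral_sub (integrable_abs_rpow_mul hγ hΦ hA)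
    (integrable_scaled_sineWeight_mul hγ hh0 hh1 hA0 hΦ hA)]
  refine (norm_integral_le_of_norm_le hint (Filter.Eventually.of_forall fun ξ => ?_)).trans_eq ?_
  · rw [← sub_mul, ← Complex.ofReal_sub, norm_mul, Complex.norm_real, norm_eq_abs]
    calc _ ≤ |(|2 * π * ξ| ^ γ - h ^ (-γ) * sineWeight γ (h * ξ))| * (A / (1 + |ξ| ^ 3)) :=
          mul_le_mul_of_nonneg_left (hA ξ) (abs_nonneg _)
      _ = A * (|(|2 * π * ξ| ^ γ - h ^ (-γ) * sineWeight γ (h * ξ))| / (1 + |ξ| ^ 3)) := by ring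
      _ ≤ _ := mul_le_mul_of_nonneg_left (abs_rpow_sub_scaled_sineWeight_div_le hγ hh0 hh1 ξ) hA0
  -- The substitution `θ = hξ` costs a factor `1/h`, turning the `h^3` of the outer term into `h^2`.
  · rw [integral_const_mul, integral_add (hint1.const_mul _) (hint2.const_mul _),
      integral_const_mul, integral_const_mul,
      Measure.integral_comp_mul_left (fun θ => sineWeight γ θ / (1 + θ ^ 2)),
      abs_of_pos (by positivity), smul_eq_mul]
    field_simp

end CubicDecay

/-! ### Fourier decay, inversion and the series representation -/

lemma continuous_fourier_of_integrable {f : ℝ → ℂ} (hf : Integrable f) : Continuous (𝓕 f) :=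
  VectorFourier.fourierIntegral_continuous Real.continuous_fourierChar
    (innerSL ℝ).continuous₂ hf

lemma norm_fourier_le_integral_norm (f : ℝ → ℂ) (ξ : ℝ) : ‖𝓕 f ξ‖ ≤ ∫ y, ‖f y‖ :=
  VectorFourier.norm_fourierIntegral_le_integral_norm _ _ _ _ _

lemma iteratedDeriv_ofReal_comp {f : ℝ → ℝ} {N : ℕ} (hf : ContDiff ℝ N f) {n : ℕ} (hn : n ≤ N) :
    iteratedDeriv n (fun y : ℝ => (f y : ℂ)) = fun y => ((iteratedDeriv n f y : ℝ) : ℂ) := by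
  ext y
  have h := Complex.ofRealCLM.iteratedFDeriv_comp_left (hf.contDiffAt (x := y))
    (i := n) (by exact_mod_cast hn)
  have h' := congrArg (fun L => L fun _ : Fin n => (1 : ℝ)) h
  simpa [iteratedDeriv_eq_iteratedFDeriv, Function.comp_def] using h'

lemma exists_norm_fourier_le {f : ℝ → ℂ} (hf : ContDiff ℝ 3 f)
    (hf_int : ∀ n : ℕ, n ≤ 3 → Integrable (iteratedDeriv n f)) :
    ∃ A : ℝ, 0 < A ∧ ∀ ξ, ‖𝓕 f ξ‖ ≤ A / (1 + |ξ| ^ 3) := by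
  have h3 := Real.fourier_iteratedDeriv (N := 3) (n := 3) hf
    (fun n hn => hf_int n (by exact_mod_cast hn)) le_rfl
  refine ⟨(∫ y, ‖f y‖) + (∫ y, ‖iteratedDeriv 3 f y‖) + 1, ?_, fun ξ => ?_⟩
  · have h1 : 0 ≤ ∫ y, ‖f y‖ := integral_nonneg fun _ => norm_nonneg _
    have h2 : 0 ≤ ∫ y, ‖iteratedDeriv 3 f y‖ := integral_nonneg fun _ => norm_nonneg _
    linarith
  · rw [le_div_iff₀ (by positivity)]
    have b0 := norm_fourier_le_integral_norm f ξ
    have b3 := norm_fourier_le_integral_norm (iteratedDeriv 3 f) ξ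
    have e : ‖(2 * π * Complex.I * ξ : ℂ)‖ = 2 * π * |ξ| := by
      simp [abs_of_pos pi_pos]
    rw [congrFun h3 ξ, norm_smul, norm_pow, e] at b3
    have hle : |ξ| ^ 3 ≤ (2 * π * |ξ|) ^ 3 := by
      refine pow_le_pow_left₀ (abs_nonneg _) ?_ 3
      have := two_le_pi
      nlinarith [abs_nonneg ξ]
    have := mul_le_mul_of_nonneg_right hle (norm_nonneg (𝓕 f ξ))
    linarith

lemma integrable_of_norm_le_cubic {Φ : ℝ → ℂ} {A : ℝ} (hΦ : Continuous Φ)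
    (hA : ∀ ξ, ‖Φ ξ‖ ≤ A / (1 + |ξ| ^ 3)) : Integrable Φ := by
  refine ((integrable_abs_rpow_div (s := 0) (by norm_num) (by norm_num)).const_mul A).mono'
    hΦ.aestronglyMeasurable (Filter.Eventually.of_forall fun ξ => (hA ξ).trans_eq ?_)
  rw [rpow_zero]
  ring

/-- The integrand of the Fourier inversion formula at `x`. -/
noncomputable def inversionIntegrand (f : ℝ → ℂ) (x ξ : ℝ) : ℂ :=
  Complex.exp (2 * π * Complex.I * x * ξ) * 𝓕 f ξ

section InversionIntegrand

variable {f : ℝ → ℂ} {x A h γ : ℝ}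

lemma norm_inversionIntegrand (ξ : ℝ) : ‖inversionIntegrand f x ξ‖ = ‖𝓕 f ξ‖ := by
  have e : 2 * π * Complex.I * x * ξ = ((2 * π * x * ξ : ℝ) : ℂ) * Complex.I := by
    push_cast; ring
  rw [inversionIntegrand, norm_mul, e, Complex.norm_exp_ofReal_mul_I, one_mul]

lemma continuous_inversionIntegrand (hf : Integrable f) :
    Continuous (inversionIntegrand f x) := by
  have := continuous_fourier_of_integrable hf
  unfold inversionIntegrand
  fun_prop

lemma fourierInv_eq_integral_exp_mul (g : ℝ → ℂ) (x : ℝ) :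
    𝓕⁻ g x = ∫ ξ : ℝ, Complex.exp (2 * π * Complex.I * x * ξ) * g ξ := by
  rw [Real.fourierInv_eq']
  refine integral_congr_ae (Filter.Eventually.of_forall fun ξ => ?_)
  simp only [smul_eq_mul]
  congr 2
  simp
  ring

/-- After rescaling, the phase `e^{-2πikθ}` shifts the inversion integral from `x` to `x - kh`: the
grid samples of `f` are Fourier samples at the integers. -/
lemma fourier_scaled_inversionIntegrand (hfc : Continuous f) (hf : Integrable f)
    (hF : Integrable (𝓕 f)) (hh : 0 < h) (k : ℤ) :
    𝓕 (fun θ : ℝ => (h⁻¹ : ℂ) * inversionIntegrand f x (h⁻¹ * θ)) k = f (x - k * h) := by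
  have hinv := congrFun (hfc.fourierInv_fourier_eq hf hF) (x - k * h)
  rw [← hinv, fourierInv_eq_integral_exp_mul, Real.fourier_real_eq_integral_exp_smul]
  have hsub := Measure.integral_comp_mul_left (fun ξ : ℝ =>
    Complex.exp (2 * π * Complex.I * (x - k * h : ℝ) * ξ) * 𝓕 f ξ) h⁻¹
  rw [inv_inv, abs_of_pos hh] at hsub
  have hh' : (h : ℂ) ≠ 0 := by exact_mod_cast hh.ne'
  have e (θ : ℝ) : Complex.exp (((-2 * π * θ * k : ℝ) : ℂ) * Complex.I) •
      ((h⁻¹ : ℂ) * inversionIntegrand f x (h⁻¹ * θ)) =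
      (h⁻¹ : ℂ) * (Complex.exp (2 * π * Complex.I * (x - k * h : ℝ) * (h⁻¹ * θ : ℝ)) *
        𝓕 f (h⁻¹ * θ)) := by
    rw [inversionIntegrand, smul_eq_mul, mul_left_comm, ← mul_assoc (Complex.exp _),
      ← Complex.exp_add]
    congr 3
    push_cast
    field_simp
    ring
  simp_rw [e]
  rw [integral_const_mul, hsub, Complex.real_smul, inv_mul_cancel_left₀ hh']

lemma hasSum_centeredCoeff_mul (hγ : γ ∈ Ioo (-1 : ℝ) 0) (hfc : Continuous f)
    (hf : Integrable f) (hA0 : 0 ≤ A) (hA : ∀ ξ, ‖𝓕 f ξ‖ ≤ A / (1 + |ξ| ^ 3)) (hh0 : 0 < h)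
    (hh1 : h ≤ 1) (hs : Summable fun k : ℤ => f (x - k * h)) :
    HasSum (fun k : ℤ => ((h ^ (-γ) * centeredCoeff γ k : ℝ) : ℂ) * f (x - k * h))
      (∫ ξ, ((h ^ (-γ) * sineWeight γ (h * ξ) : ℝ) : ℂ) * inversionIntegrand f x ξ) := by
  have hF : Integrable (𝓕 f) :=
    integrable_of_norm_le_cubic (continuous_fourier_of_integrable hf) hA
  have hΦ := continuous_inversionIntegrand (x := x) hf
  have hfour := fourier_scaled_inversionIntegrand (x := x) hfc hf hF hh0
  have hle (θ : ℝ) : ‖(h⁻¹ : ℂ) * inversionIntegrand f x (h⁻¹ * θ)‖ ≤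
      h⁻¹ * (A * 2) / (1 + θ ^ 2) := by
    rw [norm_mul, norm_inversionIntegrand, ← Complex.ofReal_inv, Complex.norm_of_nonneg
      (by positivity), mul_div_assoc, mul_div_assoc]
    refine mul_le_mul_of_nonneg_left ((hA _).trans ?_) (by positivity)
    rw [div_eq_mul_one_div]
    refine mul_le_mul_of_nonneg_left ?_ hA0
    have := one_div_one_add_abs_pow_three_le hh0 hh1 (h⁻¹ * θ)
    rwa [mul_inv_cancel_left₀ hh0.ne'] at this
  have key := hasSum_sineWeightCoeff_mul_fourier hγ.1 (by positivity)
    (Ψ := fun θ : ℝ => (h⁻¹ : ℂ) * inversionIntegrand f x (h⁻¹ * θ)) (by fun_prop) hle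
    (by simpa only [hfour] using hs)
  simp_rw [hfour, sineWeightCoeff_eq_centeredCoeff hγ] at key
  have hsub := Measure.integral_comp_mul_left (fun ξ : ℝ =>
    (sineWeight γ (h * ξ) : ℂ) * inversionIntegrand f x ξ) h⁻¹
  rw [inv_inv, abs_of_pos hh0] at hsub
  simp_rw [mul_inv_cancel_left₀ hh0.ne'] at hsub
  have hh' : (h : ℂ) ≠ 0 := by exact_mod_cast hh0.ne'
  have hint : (∫ θ, (sineWeight γ θ : ℂ) * ((h⁻¹ : ℂ) * inversionIntegrand f x (h⁻¹ * θ))) =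
      ∫ ξ, (sineWeight γ (h * ξ) : ℂ) * inversionIntegrand f x ξ := by
    simp_rw [mul_left_comm _ (h⁻¹ : ℂ)]
    rw [integral_const_mul, hsub, Complex.real_smul, inv_mul_cancel_left₀ hh']
  rw [hint] at key
  have := key.mul_left ((h ^ (-γ) : ℝ) : ℂ)
  rw [← integral_const_mul] at this
  simp_rw [Complex.ofReal_mul, mul_assoc]
  exact this

end InversionIntegrand

/-! ### Assembly of the error estimate -/

theorem theorem2 (γ : ℝ) (hγ : γ ∈ Set.Ioo (-1 : ℝ) 0) (f : ℝ → ℝ)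
    (hf : ContDiff ℝ 3 f)
    (hf_int : ∀ n : ℕ, n ≤ 3 → MeasureTheory.Integrable (iteratedDeriv n f))
    (x C : ℝ) (hC : 0 < C) :
    MeasureTheory.Integrable (rieszSymbol γ f) ∧
    ∃ M : ℝ, 0 < M ∧ ∀ᶠ h in 𝓝[>] (0 : ℝ), ∀ K : ℕ, 1 ≤ K → TailBound f x h K C →
      ‖rieszDeriv γ f x - (truncCenteredDiff γ h K f x : ℂ)‖ ≤
        M * (h ^ 2 + 1 / (h * K)) := by
  set F : ℝ → ℂ := fun y => (f y : ℂ) with hFdef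
  have hFc : ContDiff ℝ 3 F := Complex.ofRealCLM.contDiff.comp hf
  have hF_int (n : ℕ) (hn : n ≤ 3) : Integrable (iteratedDeriv n F) := by
    rw [iteratedDeriv_ofReal_comp (N := 3) (by exact_mod_cast hf) hn]
    exact (hf_int n hn).ofReal
  have hF0 : Integrable F := by simpa using hF_int 0 (by norm_num)
  obtain ⟨A, hA0, hA⟩ := exists_norm_fourier_le hFc hF_int
  have hΦA (ξ : ℝ) : ‖inversionIntegrand F x ξ‖ ≤ A / (1 + |ξ| ^ 3) :=
    (norm_inversionIntegrand ξ).trans_le (hA ξ)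
  have hΦ := continuous_inversionIntegrand (x := x) hF0
  obtain ⟨c, hc, hg⟩ := exists_abs_centeredCoeff_le hγ
  refine ⟨integrable_abs_rpow_mul hγ (continuous_fourier_of_integrable hF0) hA, ?_⟩
  set J := π ^ 3 * (∫ ξ : ℝ, |ξ| ^ (γ + 2) / (1 + |ξ| ^ 3)) +
    10 * ∫ θ, sineWeight γ θ / (1 + θ ^ 2)
  have hJ : 0 ≤ J := by
    have h1 : 0 ≤ ∫ ξ : ℝ, |ξ| ^ (γ + 2) / (1 + |ξ| ^ 3) :=
      integral_nonneg fun _ => by positivity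
    have h2 : 0 ≤ ∫ θ, sineWeight γ θ / (1 + θ ^ 2) :=
      integral_nonneg fun θ => div_nonneg (sineWeight_nonneg γ θ) (by positivity)
    positivity
  -- `A * J` is the symbol error and `4 * c * C` comes from the tail bound `2B/K` with `B = 2cC/h`.
  -- The threshold for `h` is `1`.
  refine ⟨A * J + 4 * c * C, by positivity, ?_⟩
  filter_upwards [Ioc_mem_nhdsGT one_pos] with h ⟨hh0, hh1⟩ K hK hb
  have hK0 : (0 : ℝ) < K := by exact_mod_cast hK
  have hsum : Summable fun k : ℤ => F (x - k * h) :=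
    Complex.hasSum_ofReal.2 (hb.summable hC hh0).hasSum |>.summable
  have hseries := hasSum_centeredCoeff_mul hγ hFc.continuous hF0 hA0.le hA hh0 hh1 hsum
  have hsin := norm_integral_sub_integral_le hγ hh0 hh1 hA0.le hΦ hΦA
  have htail := norm_hasSum_sub_sum_Icc_le hseries hK (B := 2 * c * C / h) (by positivity)
    fun k hk => by
      have := abs_centeredCoeff_mul_le_of_tailBound hγ hc hg hb hC hh0 hk
      rwa [← mul_assoc, ← norm_eq_abs, ← Complex.norm_real, Complex.ofReal_mul] at this
  have hriesz : rieszDeriv γ f x =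
      ∫ ξ, ((|2 * π * ξ| ^ γ : ℝ) : ℂ) * inversionIntegrand F x ξ := by
    rw [rieszDeriv, fourierInv_eq_integral_exp_mul]
    refine integral_congr_ae (Filter.Eventually.of_forall fun ξ => ?_)
    simp only [rieszSymbol, inversionIntegrand]
    ring
  have htrunc : (truncCenteredDiff γ h K f x : ℂ) =
      ∑ k ∈ Finset.Icc (-(K : ℤ)) K, ((h ^ (-γ) * centeredCoeff γ k : ℝ) : ℂ) * F (x - k * h) := by
    rw [truncCenteredDiff, one_div, ← rpow_neg hh0.le, Finset.mul_sum]
    push_cast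
    exact Finset.sum_congr rfl fun k _ => by rw [mul_assoc]
  rw [hriesz, htrunc]
  refine (norm_sub_le_norm_sub_add_norm_sub _ _ _).trans ((add_le_add hsin htail).trans ?_)
  have e : 2 * (2 * c * C / h) / K = 4 * c * C * (1 / (h * K)) := by field_simp; ring
  rw [e]
  -- These nonnegative cross terms allow a single constant in front of both parts of the error.
  have p1 : 0 ≤ A * J * (1 / (h * K)) := by positivity
  have p2 : 0 ≤ 4 * c * C * h ^ 2 := by positivity
  linarith
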